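/- Let $\mathfrak{A}$ be a (not necessarily unital) $C^*$-algebra and let $\mathscr{X}$ be a right Hilbert $\mathfrak{A}$-module with inner product $\langle\cdot,\cdot\rangle$, linear in the second variable; write $|a|^2=a^*a$ for $a\in\mathfrak{A}$. Let $n\in\mathbb{N}$. For $y=(y_1,\dots,y_n)\in\mathscr{X}^n$ put $$\mu_n^*(y)=\sup\Big\{\Big\|\Big(\sum_{i=1}^n|\langle y_i,z\rangle|^2\Big)^{1/2}\Big\| : z\in\mathscr{X},\ \|z\|\le 1\Big\},$$ and for $x=(x_1,\dots,x_n)\in\mathscr{X}^n$ put $$\|x\|_n^*=\sup\Big\{\Big\|\sum_{i=1}^n|\langle y_i,x_i\rangle|^2\Big\|^{1/2} : y\in\mathscr{X}^n,\ \mu_n^*(y)\le 1\Big\},\qquad \|x\|_n^{\mathscr{X}}=\sup\|P_1x_1+\dots+P_nx_n\|,$$ where the last supremum is over all families $(P_1,\dots,P_n)$ of mutually orthogonal projections (possibly zero) in the algebra of adjointable operators on $\mathscr{X}$ with $P_1+\dots+P_n=I_{\mathscr{X}}$; for a Hilbert space $\mathscr{H}$ (a Hilbert $\mathbb{C}$-module)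 this defines $\|\cdot\|_n^{\mathscr{H}}$. Let $\mathcal{P}(\mathfrak{A})$ be the set of pure states of $\mathfrak{A}$. For $\tau\in\mathcal{P}(\mathfrak{A})$ let $\mathcal{N}_\tau=\{x\in\mathscr{X}:\tau(\langle x,x\rangle)=0\}$ and let $\mathscr{H}_\tau$ be the Hilbert space completion of $\mathscr{X}/\mathcal{N}_\tau$ with respect to $\langle x+\mathcal{N}_\tau,y+\mathcal{N}_\tau\rangle=\tau(\langle x,y\rangle)$. Put $$\|x\|_n^{\mathcal{P}(\mathfrak{A})}=\sup_{\tau\in\mathcal{P}(\mathfrak{A})}\|(x_1+\mathcal{N}_\tau,\dots,x_n+\mathcal{N}_\tau)\|_n^{\mathscr{H}_\tau}$$ (a supremum over the empty set is $0$). Then for every $x\in\mathscr{X}^n$: (1) $\|x\|_n^{\mathscr{X}}\le\|x\|_n^*$; (2) $\|x\|_n^{\mathscr{X}}\le\|x\|_n^{\mathcal{P}(\mathfrak{A})}$; (3) if $\mathfrak{A}$ is commutative and for every $\tau\in\mathcal{P}(\mathfrak{A})$ the Hilbert dimension of $\mathscr{H}_\tau$ (the cardinality of an orthonormal basis) is at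 least $n$, then $\|x\|_n^*\le\|x\|_n^{\mathcal{P}(\mathfrak{A})}$. -/

import Mathlib

open scoped ComplexOrder

noncomputable section

namespace HilbertMultiNorm

section RightModule

/-! A right Hilbert module over a (not necessarily unital) C⋆-algebra `A` is a complete space `E`
with `[SMul Aᵐᵒᵖ E] [CStarModule Aᵐᵒᵖ E]`: Mathlib's `CStarModule B E` is built on a left action of
`B`, with `⟨x, b y⟩ = b ⟨x, y⟩`, so over `B = Aᵐᵒᵖ` it reads `⟨x, y a⟩ = ⟨x, y⟩ a` in `A`.
The module laws for the action follow from the axioms on the inner product. -/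

variable {A E : Type*} [NonUnitalCStarAlgebra A] [PartialOrder A]
  [NormedAddCommGroup E] [NormedSpace ℂ E] [SMul Aᵐᵒᵖ E] [CStarModule Aᵐᵒᵖ E]

variable (A) in
/-- The `A`-valued inner product of a right Hilbert `A`-module, conjugate linear in `x` and linear
in `y`. -/
def rinner (x y : E) : A := MulOpposite.unop (inner Aᵐᵒᵖ x y)

/-- `⟨x, y a⟩ = ⟨x, y⟩ a`. -/
lemma rinner_smul_right (x y : E) (a : A) :
    rinner A x (MulOpposite.op a • y) = rinner A x y * a := by
  simp [rinner]

lemma star_rinner (x y : E) : star (rinner A x y) = rinner A y x := by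
  simp [rinner, ← MulOpposite.unop_star]

lemma rinner_self_nonneg (x : E) : 0 ≤ rinner A x x :=
  CStarModule.inner_self_nonneg (A := Aᵐᵒᵖ) (x := x)

lemma norm_eq_sqrt_norm_rinner_self (x : E) : ‖x‖ = √‖rinner A x x‖ :=
  CStarModule.norm_eq_sqrt_norm_inner_self (A := Aᵐᵒᵖ) x

/-- `|a|² = a⋆ a` in a C⋆-algebra. -/
def absSq (a : A) : A := star a * a

variable [StarOrderedRing A]

variable (A) in
/-- `μ*ₙ(y₁, …, yₙ) = sup { ‖(∑ᵢ |⟨yᵢ, z⟩|²)^(1/2)‖ : ‖z‖ ≤ 1 }`. -/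
def muStar {n : ℕ} (y : Fin n → E) : ℝ :=
  sSup {r : ℝ | ∃ z : E, ‖z‖ ≤ 1 ∧ r = ‖CFC.sqrt (∑ i, absSq (rinner A (y i) z))‖}

variable (A) in
/-- `‖(x₁, …, xₙ)‖*ₙ = sup { ‖∑ᵢ |⟨yᵢ, xᵢ⟩|²‖^(1/2) : μ*ₙ(y₁, …, yₙ) ≤ 1 }`. -/
def starNorm {n : ℕ} (x : Fin n → E) : ℝ :=
  sSup {r : ℝ | ∃ y : Fin n → E, muStar A y ≤ 1 ∧
    r = √‖∑ i, absSq (rinner A (y i) (x i))‖}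

end RightModule

section Projections

/-- `S` is an adjoint of the map `T`, for an inner product with values in `R`. A map that has an
adjoint is called adjointable; linearity and boundedness are automatic in Hilbert modules. -/
def IsAdjoint (R : Type*) {E F : Type*} [Inner R E] [Inner R F] (T : E → F) (S : F → E) : Prop :=
  ∀ x y, inner R (T x) y = inner R x (S y)

/-- `P` is a projection in the algebra of adjointable operators: `P = P⋆ = P²`. -/
structure IsProj (R : Type*) {E : Type*} [Inner R E] (P : E → E) : Prop where
  selfAdjoint : IsAdjoint R P P
  idempotent : ∀ x, P (P x) = P x

/-- `P₁, …, Pₙ` are mutually orthogonal projections (some of them possibly zero) whose sum is the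
identity. -/
structure IsProjFamily (R : Type*) {E : Type*} [AddCommGroup E] [Inner R E] {n : ℕ}
    (P : Fin n → E → E) : Prop where
  isProj : ∀ i, IsProj R (P i)
  orthogonal : ∀ i j, i ≠ j → ∀ x, P i (P j x) = 0
  sum_eq : ∀ x, ∑ i, P i x = x

/-- The Hilbert multi-norm `sup ‖P₁ x₁ + ⋯ + Pₙ xₙ‖` over all families of mutually orthogonal
projections summing to the identity. With `R = Aᵐᵒᵖ` this is the Hilbert C⋆-multi-norm of a right
Hilbert `A`-module, with `R = ℂ` the Hilbert multi-norm of a Hilbert space. -/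
def hilbertMultiNorm (R : Type*) {E : Type*} [NormedAddCommGroup E] [Inner R E] {n : ℕ}
    (x : Fin n → E) : ℝ :=
  sSup {r : ℝ | ∃ P : Fin n → E → E, IsProjFamily R P ∧ r = ‖∑ i, P i (x i)‖}

end Projections

section PureStates

/-- A positive linear functional on a C⋆-algebra as a bounded functional (it is automatically
continuous). -/
def toDual {A : Type*} [NonUnitalCStarAlgebra A] [PartialOrder A] [StarOrderedRing A]
    (τ : A →ₚ[ℂ] ℂ) : A →L[ℂ] ℂ where
  toLinearMap := τ.toLinearMap
  cont := map_continuous τ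

/-- A pure state of a C⋆-algebra: a positive linear functional `τ` of norm one such that every
positive functional `ρ ≤ τ` is a multiple `t τ` with `0 ≤ t ≤ 1`. -/
structure IsPureState {A : Type*} [NonUnitalCStarAlgebra A] [PartialOrder A] [StarOrderedRing A]
    (τ : A →ₚ[ℂ] ℂ) : Prop where
  norm_eq_one : ‖toDual τ‖ = 1
  minimal : ∀ ρ : A →ₚ[ℂ] ℂ, (∀ a, 0 ≤ a → ρ a ≤ τ a) →
    ∃ t : ℝ, 0 ≤ t ∧ t ≤ 1 ∧ ∀ a, ρ a = t * τ a

/-- The set of pure states of `A`. -/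
def PureState (A : Type*) [NonUnitalCStarAlgebra A] [PartialOrder A] [StarOrderedRing A] :=
  {τ : A →ₚ[ℂ] ℂ // IsPureState τ}

end PureStates

section GNS

variable {A : Type*} [NonUnitalCStarAlgebra A] [PartialOrder A]

/-- A copy of the Hilbert module `E`, to carry the semi-inner product `τ(⟨x, y⟩)`. -/
@[nolint unusedArguments]
def PreGNS (_τ : A →ₚ[ℂ] ℂ) (E : Type*) := E

variable (τ : A →ₚ[ℂ] ℂ) (E : Type*)
  [NormedAddCommGroup E] [NormedSpace ℂ E]

instance : AddCommGroup (PreGNS τ E) := inferInstanceAs (AddCommGroup E)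
instance : Module ℂ (PreGNS τ E) := inferInstanceAs (Module ℂ E)

/-- The identity map from `E` to its copy. -/
def toPreGNS : E ≃ₗ[ℂ] PreGNS τ E := LinearEquiv.refl ℂ _

variable [StarOrderedRing A] [SMul Aᵐᵒᵖ E] [CStarModule Aᵐᵒᵖ E]

/-- The semi-inner product `τ(⟨x, y⟩)`. -/
abbrev preGNSCore : PreInnerProductSpace.Core ℂ (PreGNS τ E) where
  inner x y := τ (rinner A ((toPreGNS τ E).symm x) ((toPreGNS τ E).symm y))
  conj_inner_symm x y := by
    rw [← star_rinner (A := A) ((toPreGNS τ E).symm x), map_star τ]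
    exact star_star _
  re_inner_nonneg x :=
    (RCLike.nonneg_iff.mp (τ.map_nonneg (rinner_self_nonneg ((toPreGNS τ E).symm x)))).1
  add_left x y z := by simp [rinner]
  smul_left x y c := by simp [rinner]

instance : SeminormedAddCommGroup (PreGNS τ E) :=
  InnerProductSpace.Core.toSeminormedAddCommGroup (c := preGNSCore τ E)

instance : InnerProductSpace ℂ (PreGNS τ E) :=
  InnerProductSpace.ofCore (preGNSCore τ E)

lemma preGNS_inner (x y : E) :
    inner ℂ (toPreGNS τ E x) (toPreGNS τ E y) = τ (rinner A x y) := rfl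

/-- The Hilbert space `H_τ`: the completion of `E / N_τ`, `N_τ = {x | τ(⟨x, x⟩) = 0}`, with
`⟨x + N_τ, y + N_τ⟩ = τ(⟨x, y⟩)`. The Hausdorff completion of `PreGNS τ E` includes the passage to
the quotient by the vectors of seminorm zero. -/
abbrev GNSSpace := UniformSpace.Completion (PreGNS τ E)

variable {E} in
/-- The class `x + N_τ` in `H_τ`. -/
def gnsClass (x : E) : GNSSpace τ E := (toPreGNS τ E x : UniformSpace.Completion (PreGNS τ E))

lemma gnsClass_inner (x y : E) :
    inner ℂ (gnsClass τ x) (gnsClass τ y) = τ (rinner A x y) := by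
  simp only [gnsClass, UniformSpace.Completion.inner_coe, preGNS_inner]

variable (A) {E} in
/-- The supremum over all pure states `τ` of the Hilbert multi-norm of
`(x₁ + N_τ, …, xₙ + N_τ)` in `H_τ`. -/
def pureNorm {n : ℕ} (x : Fin n → E) : ℝ :=
  ⨆ τ : PureState A, hilbertMultiNorm ℂ (fun i => gnsClass τ.1 (x i))

end GNS

/-- The Hilbert dimension: the cardinal number of an orthonormal basis. -/
def oDim (H : Type*) [NormedAddCommGroup H] [InnerProductSpace ℂ H] [CompleteSpace H] :
    Cardinal :=
  Cardinal.mk ↥(exists_hilbertBasis ℂ H).choose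

end HilbertMultiNorm

end

/-! **(1)** Given projections `P i`, put `u i = P i (x i)`. The normalizations
`y i = u i ⟨u i, u i⟩ ^ (-1/2)` lie in orthogonal submodules, so `μ*(y) ≤ 1` by Bessel's inequality,
and `∑ |⟨y i, x i⟩|² = ∑ ⟨u i, u i⟩ = |∑ P i (x i)|²`. As `⟨u i, u i⟩` need not be invertible, the
inverse square root is truncated near `0` and the truncation is let go to zero.

**(2)** The norm of `⟨z, z⟩` is attained by a pure state `τ`, namely an extreme point of the weak-*
compact convex set of functionals of norm at most one that attain it, and an adjointable projection
on `E` induces a projection on `H_τ`.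

**(3)** Pure states of a commutative `A` are characters. Hence `μ*(y) ≤ 1` says that
`T : c ↦ ∑ c i • (y i + N_τ)` is a contraction from `ℂⁿ` to `H_τ` for each pure `τ`. Since
`dim H_τ ≥ n`, injective contractions are dense among contractions, and an injective one is the
midpoint of two isometries: in its polar decomposition `V a`, replace `a` by the unitaries
`a ± i √(1 - a²)`. For an isometry the vectors `T (e i)` are orthonormal, and projecting onto their
lines bounds `∑ |⟨y i, x i⟩|²` by the Hilbert multi-norm of `x + N_τ`. -/

noncomputable section

namespace HilbertMultiNorm

section RightModule

variable {A E : Type*} [NonUnitalCStarAlgebra A] [PartialOrder A]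
  [NormedAddCommGroup E] [NormedSpace ℂ E] [SMul Aᵐᵒᵖ E] [CStarModule Aᵐᵒᵖ E]

lemma rinner_add_right (x y z : E) : rinner A x (y + z) = rinner A x y + rinner A x z := by
  simp [rinner]

lemma rinner_sub_right (x y z : E) : rinner A x (y - z) = rinner A x y - rinner A x z := by
  simp [rinner]

lemma rinner_complex_smul_right (c : ℂ) (x y : E) : rinner A x (c • y) = c • rinner A x y := by
  simp [rinner]

lemma rinner_sum_right {ι : Type*} (s : Finset ι) (x : E) (y : ι → E) :
    rinner A x (∑ i ∈ s, y i) = ∑ i ∈ s, rinner A x (y i) := by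
  simp [rinner]

lemma rinner_sum_left {ι : Type*} (s : Finset ι) (x : ι → E) (y : E) :
    rinner A (∑ i ∈ s, x i) y = ∑ i ∈ s, rinner A (x i) y := by
  simp [rinner]

lemma rinner_smul_left (x y : E) (a : A) :
    rinner A (MulOpposite.op a • x) y = star a * rinner A x y := by
  simp [rinner]

lemma norm_rinner_self (x : E) : ‖rinner A x x‖ = ‖x‖ ^ 2 := by
  rw [norm_eq_sqrt_norm_rinner_self (A := A) x, Real.sq_sqrt (norm_nonneg _)]

lemma eq_of_forall_rinner_eq {x y : E} (h : ∀ z, rinner A z x = rinner A z y) : x = y := by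
  have hself : rinner A (x - y) (x - y) = 0 := by rw [rinner_sub_right, h, sub_self]
  rw [← sub_eq_zero, ← norm_eq_zero, norm_eq_sqrt_norm_rinner_self (A := A), hself, norm_zero,
    Real.sqrt_zero]

lemma absSq_rinner (x y : E) : absSq (rinner A x y) = rinner A y x * rinner A x y := by
  rw [absSq, star_rinner]

lemma norm_absSq {A : Type*} [NonUnitalCStarAlgebra A] (a : A) : ‖absSq a‖ = ‖a‖ ^ 2 := by
  rw [absSq, CStarRing.norm_star_mul_self, sq]

variable [StarOrderedRing A]

lemma absSq_nonneg (a : A) : 0 ≤ absSq a := star_mul_self_nonneg a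

lemma sum_absSq_nonneg {ι : Type*} (s : Finset ι) (a : ι → A) : 0 ≤ ∑ i ∈ s, absSq (a i) :=
  Finset.sum_nonneg fun i _ => absSq_nonneg (a i)

lemma absSq_rinner_le (x y : E) : absSq (rinner A x y) ≤ ‖x‖ ^ 2 • rinner A y y := by
  rw [absSq_rinner]
  exact CStarModule.inner_mul_inner_swap_le (A := Aᵐᵒᵖ)

lemma norm_rinner_le (x y : E) : ‖rinner A x y‖ ≤ ‖x‖ * ‖y‖ :=
  CStarModule.norm_inner_le (A := Aᵐᵒᵖ) E

end RightModule

section MuStar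

variable {A E : Type*} [NonUnitalCStarAlgebra A] [PartialOrder A] [StarOrderedRing A]
  [NormedAddCommGroup E] [NormedSpace ℂ E] [SMul Aᵐᵒᵖ E] [CStarModule Aᵐᵒᵖ E] {n : ℕ}

lemma norm_sqrt_sum_absSq {ι : Type*} (s : Finset ι) (a : ι → A) :
    ‖CFC.sqrt (∑ i ∈ s, absSq (a i))‖ = √‖∑ i ∈ s, absSq (a i)‖ :=
  CFC.norm_sqrt _ (sum_absSq_nonneg s a)

lemma bddAbove_muStar (y : Fin n → E) :
    BddAbove {r : ℝ | ∃ z : E, ‖z‖ ≤ 1 ∧ r = ‖CFC.sqrt (∑ i, absSq (rinner A (y i) z))‖} := by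
  refine ⟨√(∑ i, ‖y i‖ ^ 2), ?_⟩
  rintro _ ⟨z, hz, rfl⟩
  rw [norm_sqrt_sum_absSq]
  refine Real.sqrt_le_sqrt ((norm_sum_le _ _).trans (Finset.sum_le_sum fun i _ => ?_))
  rw [norm_absSq]
  gcongr
  exact (norm_rinner_le _ _).trans (mul_le_of_le_one_right (norm_nonneg _) hz)

lemma muStar_le_one_iff (y : Fin n → E) :
    muStar A y ≤ 1 ↔ ∀ z : E, ‖z‖ ≤ 1 → ‖∑ i, absSq (rinner A (y i) z)‖ ≤ 1 := by
  constructor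
  · intro h z hz
    have hle := (le_csSup (bddAbove_muStar (A := A) y) ⟨z, hz, rfl⟩).trans h
    rwa [norm_sqrt_sum_absSq, Real.sqrt_le_one] at hle
  · intro h
    refine Real.sSup_le ?_ zero_le_one
    rintro _ ⟨z, hz, rfl⟩
    rw [norm_sqrt_sum_absSq, Real.sqrt_le_one]
    exact h z hz

lemma norm_rinner_le_of_muStar_le_one {y : Fin n → E} (hy : muStar A y ≤ 1) (i : Fin n) (x : E) :
    ‖rinner A (y i) x‖ ≤ ‖x‖ := by
  have hball (z : E) (hz : ‖z‖ ≤ 1) : ‖rinner A (y i) z‖ ≤ 1 := by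
    have hle := CStarAlgebra.norm_le_norm_of_nonneg_of_le (absSq_nonneg (rinner A (y i) z))
      (Finset.single_le_sum (f := fun i => absSq (rinner A (y i) z))
        (fun j _ => absSq_nonneg _) (Finset.mem_univ i))
    rw [norm_absSq] at hle
    exact (sq_le_one_iff₀ (norm_nonneg _)).1 (hle.trans ((muStar_le_one_iff y).1 hy z hz))
  rcases eq_or_ne x 0 with rfl | hx
  · simp [rinner]
  have hx' : 0 < ‖x‖ := norm_pos_iff.2 hx
  have hunit := hball (((‖x‖⁻¹ : ℝ) : ℂ) • x) (by simp [norm_smul, hx'.ne'])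
  rw [rinner_complex_smul_right, norm_smul, Complex.norm_real, norm_inv, norm_norm] at hunit
  rwa [inv_mul_le_iff₀ hx', mul_one] at hunit

lemma bddAbove_starNorm (x : Fin n → E) :
    BddAbove {r : ℝ | ∃ y : Fin n → E, muStar A y ≤ 1 ∧
      r = √‖∑ i, absSq (rinner A (y i) (x i))‖} := by
  refine ⟨√(∑ i, ‖x i‖ ^ 2), ?_⟩
  rintro _ ⟨y, hy, rfl⟩
  refine Real.sqrt_le_sqrt ((norm_sum_le _ _).trans (Finset.sum_le_sum fun i _ => ?_))
  rw [norm_absSq]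
  gcongr
  exact norm_rinner_le_of_muStar_le_one hy i _

lemma starNorm_nonneg (x : Fin n → E) : 0 ≤ starNorm A x :=
  Real.sSup_nonneg (by rintro _ ⟨y, -, rfl⟩; exact Real.sqrt_nonneg _)

lemma norm_sum_absSq_le_starNorm_sq {y : Fin n → E} (hy : muStar A y ≤ 1) (x : Fin n → E) :
    ‖∑ i, absSq (rinner A (y i) (x i))‖ ≤ starNorm A x ^ 2 :=
  (Real.sqrt_le_left (starNorm_nonneg x)).1 (le_csSup (bddAbove_starNorm x) ⟨y, hy, rfl⟩)

end MuStar

section Normalize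

/-- `t ↦ √t / max t ε`, a truncation at `ε` of `t ↦ t^(-1/2)`. It vanishes at zero, so that the
non-unital functional calculus applies to it. -/
def truncInvSqrt (ε t : ℝ) : ℝ := √t / max t ε

lemma continuous_truncInvSqrt {ε : ℝ} (hε : 0 < ε) : Continuous (truncInvSqrt ε) :=
  Real.continuous_sqrt.div (by fun_prop) fun t => (lt_max_of_lt_right hε).ne'

@[simp] lemma truncInvSqrt_zero (ε : ℝ) : truncInvSqrt ε 0 = 0 := by simp [truncInvSqrt]

lemma truncInvSqrt_sq {t : ℝ} (ε : ℝ) (ht : 0 ≤ t) :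
    truncInvSqrt ε t ^ 2 = t / max t ε ^ 2 := by
  rw [truncInvSqrt, div_pow, Real.sq_sqrt ht]

lemma truncInvSqrt_self_sq {t : ℝ} (ht : 0 < t) : truncInvSqrt t t ^ 2 = t⁻¹ := by
  rw [truncInvSqrt_sq t ht.le, max_self, sq, div_mul_cancel_left₀ ht.ne']

lemma truncInvSqrt_sq_mul_le_one {ε t : ℝ} (hε : 0 < ε) (ht : 0 ≤ t) :
    truncInvSqrt ε t ^ 2 * t ≤ 1 := by
  have : 0 < max t ε := lt_max_of_lt_right hε
  rw [truncInvSqrt_sq ε ht, div_mul_eq_mul_div, div_le_one (by positivity), ← sq]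
  gcongr
  exact le_max_left _ _

lemma abs_sub_truncInvSqrt_mul_sq_le {ε t : ℝ} (hε : 0 < ε) (ht : 0 ≤ t) :
    |t - (truncInvSqrt ε t * t) ^ 2| ≤ ε := by
  rcases le_total ε t with h | h
  · have heq : (truncInvSqrt ε t * t) ^ 2 = t := by
      have ht₀ : t ≠ 0 := (hε.trans_le h).ne'
      rw [mul_pow, truncInvSqrt_sq ε ht, max_eq_left h]
      field_simp
    simpa [heq] using hε.le
  · have hle : (truncInvSqrt ε t * t) ^ 2 ≤ t := by
      rw [mul_pow, sq t, ← mul_assoc]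
      exact mul_le_of_le_one_left ht (truncInvSqrt_sq_mul_le_one hε ht)
    rw [abs_of_nonneg (sub_nonneg.2 hle)]
    linarith [sq_nonneg (truncInvSqrt ε t * t)]

variable {A E : Type*} [NonUnitalCStarAlgebra A] [PartialOrder A]
  [NormedAddCommGroup E] [NormedSpace ℂ E] [SMul Aᵐᵒᵖ E] [CStarModule Aᵐᵒᵖ E]

variable (A) in
/-- The vector `u ⟨u, u⟩^(-1/2)`, where the power is truncated at `ε`: a multiple of `u` in the
unit ball, which serves as the polar part of `u`. -/
def normalize (ε : ℝ) (u : E) : E :=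
  MulOpposite.op (cfcₙ (truncInvSqrt ε) (rinner A u u)) • u

lemma star_cfcₙ_real {A : Type*} [NonUnitalCStarAlgebra A] (f : ℝ → ℝ) (a : A) :
    star (cfcₙ f a) = cfcₙ f a :=
  (IsSelfAdjoint.cfcₙ (f := f) (a := a)).star_eq

lemma rinner_normalize_left (ε : ℝ) (u v : E) :
    rinner A (normalize A ε u) v = cfcₙ (truncInvSqrt ε) (rinner A u u) * rinner A u v := by
  rw [normalize, rinner_smul_left, star_cfcₙ_real]

variable [StarOrderedRing A]

lemma norm_normalize_le_one {ε : ℝ} (hε : 0 < ε) (u : E) : ‖normalize A ε u‖ ≤ 1 := by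
  have hc := rinner_self_nonneg (A := A) u
  have hf := continuous_truncInvSqrt hε
  have hinner : rinner A (normalize A ε u) (normalize A ε u) =
      cfcₙ (fun t => truncInvSqrt ε t * (t * truncInvSqrt ε t)) (rinner A u u) := by
    rw [rinner_normalize_left, normalize, rinner_smul_right,
      cfcₙ_mul (truncInvSqrt ε) (fun t => t * truncInvSqrt ε t) (rinner A u u),
      cfcₙ_mul (fun t => t) (truncInvSqrt ε) (rinner A u u), cfcₙ_id' ℝ (rinner A u u)]
  rw [norm_eq_sqrt_norm_rinner_self (A := A), Real.sqrt_le_one, hinner]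
  refine norm_cfcₙ_le fun t ht => ?_
  have ht₀ := quasispectrum_nonneg_of_nonneg _ hc t ht
  have hsq : truncInvSqrt ε t * (t * truncInvSqrt ε t) = truncInvSqrt ε t ^ 2 * t := by ring
  rw [hsq, Real.norm_of_nonneg (by positivity)]
  exact truncInvSqrt_sq_mul_le_one hε ht₀

lemma norm_sub_absSq_cfcₙ_truncInvSqrt_mul_le {ε : ℝ} (hε : 0 < ε) {c : A} (hc : 0 ≤ c) :
    ‖c - absSq (cfcₙ (truncInvSqrt ε) c * c)‖ ≤ ε := by
  have hf := continuous_truncInvSqrt hε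
  have hmul : cfcₙ (truncInvSqrt ε) c * c = cfcₙ (fun t => truncInvSqrt ε t * t) c := by
    rw [cfcₙ_mul (truncInvSqrt ε) (fun t => t) c, cfcₙ_id' ℝ c]
  have hcfc : c - absSq (cfcₙ (truncInvSqrt ε) c * c) =
      cfcₙ (fun t => t - (truncInvSqrt ε t * t) ^ 2) c := by
    simp only [sq]
    rw [cfcₙ_sub (fun t => t) (fun t => truncInvSqrt ε t * t * (truncInvSqrt ε t * t)) c,
      cfcₙ_mul (fun t => truncInvSqrt ε t * t) (fun t => truncInvSqrt ε t * t) c, cfcₙ_id' ℝ c,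
      hmul, absSq, star_cfcₙ_real]
  rw [hcfc]
  exact norm_cfcₙ_le fun t ht =>
    abs_sub_truncInvSqrt_mul_sq_le hε (quasispectrum_nonneg_of_nonneg c hc t ht)

end Normalize

section Projections

variable {A E : Type*} [NonUnitalCStarAlgebra A] [PartialOrder A]
  [NormedAddCommGroup E] [NormedSpace ℂ E] [SMul Aᵐᵒᵖ E] [CStarModule Aᵐᵒᵖ E] {n : ℕ}

lemma IsProj.rinner_left {P : E → E} (hP : IsProj Aᵐᵒᵖ P) (x y : E) :
    rinner A (P x) y = rinner A x (P y) :=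
  congrArg MulOpposite.unop (hP.selfAdjoint x y)

lemma IsProj.map_add {P : E → E} (hP : IsProj Aᵐᵒᵖ P) (x y : E) : P (x + y) = P x + P y :=
  eq_of_forall_rinner_eq (A := A) fun z => by
    simp only [rinner_add_right, ← hP.rinner_left]

lemma IsProj.map_smul {P : E → E} (hP : IsProj Aᵐᵒᵖ P) (c : ℂ) (x : E) : P (c • x) = c • P x :=
  eq_of_forall_rinner_eq (A := A) fun z => by
    simp only [rinner_complex_smul_right, ← hP.rinner_left]

lemma IsProj.map_op_smul {P : E → E} (hP : IsProj Aᵐᵒᵖ P) (a : A) (x : E) :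
    P (MulOpposite.op a • x) = MulOpposite.op a • P x :=
  eq_of_forall_rinner_eq (A := A) fun z => by
    simp only [rinner_smul_right, ← hP.rinner_left]

lemma IsProj.rinner_map_map_self {P : E → E} (hP : IsProj Aᵐᵒᵖ P) (x : E) :
    rinner A (P x) (P x) = rinner A (P x) x := by
  rw [← hP.rinner_left, hP.idempotent]

lemma IsProjFamily.rinner_map_map_of_ne {P : Fin n → E → E} (hP : IsProjFamily Aᵐᵒᵖ P)
    {i j : Fin n} (hij : i ≠ j) (x y : E) : rinner A (P i x) (P j y) = 0 := by
  rw [(hP.isProj i).rinner_left, hP.orthogonal i j hij]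
  simp [rinner]

lemma IsProjFamily.rinner_sum_self {P : Fin n → E → E} (hP : IsProjFamily Aᵐᵒᵖ P)
    (x : Fin n → E) :
    rinner A (∑ i, P i (x i)) (∑ i, P i (x i)) = ∑ i, rinner A (P i (x i)) (P i (x i)) := by
  rw [rinner_sum_left]
  refine Finset.sum_congr rfl fun i _ => ?_
  rw [rinner_sum_right]
  exact Finset.sum_eq_single i (fun j _ hj => hP.rinner_map_map_of_ne hj.symm _ _) (by simp)

variable [StarOrderedRing A]

lemma IsProj.absSq_rinner_le {P : E → E} (hP : IsProj Aᵐᵒᵖ P) {y : E} (hPy : P y = y)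
    (hy : ‖y‖ ≤ 1) (z : E) : absSq (rinner A y z) ≤ rinner A (P z) (P z) := by
  have hPz := rinner_self_nonneg (A := A) (P z)
  calc absSq (rinner A y z) = absSq (rinner A y (P z)) := by rw [← hP.rinner_left, hPy]
    _ ≤ ‖y‖ ^ 2 • rinner A (P z) (P z) := HilbertMultiNorm.absSq_rinner_le y (P z)
    _ ≤ (1 : ℝ) • rinner A (P z) (P z) :=
      smul_le_smul_of_nonneg_right (pow_le_one₀ (norm_nonneg _) hy) hPz
    _ = rinner A (P z) (P z) := one_smul _ _

lemma IsProjFamily.muStar_le_one {P : Fin n → E → E} (hP : IsProjFamily Aᵐᵒᵖ P)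
    {y : Fin n → E} (hPy : ∀ i, P i (y i) = y i) (hy : ∀ i, ‖y i‖ ≤ 1) : muStar A y ≤ 1 := by
  rw [muStar_le_one_iff]
  intro z hz
  have hle : ∑ i, absSq (rinner A (y i) z) ≤ rinner A z z := by
    calc _ ≤ ∑ i, rinner A (P i z) (P i z) :=
          Finset.sum_le_sum fun i _ => (hP.isProj i).absSq_rinner_le (hPy i) (hy i) z
      _ = rinner A z z := by rw [← hP.rinner_sum_self fun _ => z, hP.sum_eq]
  refine (CStarAlgebra.norm_le_norm_of_nonneg_of_le (sum_absSq_nonneg _ _) hle).trans ?_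
  rw [norm_rinner_self]
  exact pow_le_one₀ (norm_nonneg _) hz

lemma IsProjFamily.norm_sum_sq_le {P : Fin n → E → E} (hP : IsProjFamily Aᵐᵒᵖ P)
    (x : Fin n → E) {ε : ℝ} (hε : 0 < ε) :
    ‖∑ i, P i (x i)‖ ^ 2 ≤ starNorm A x ^ 2 + n * ε := by
  set y : Fin n → E := fun i => normalize A ε (P i (x i)) with hy
  have hmu : muStar A y ≤ 1 := hP.muStar_le_one
    (fun i => by simp only [hy, normalize, (hP.isProj i).map_op_smul, (hP.isProj i).idempotent])
    fun i => norm_normalize_le_one hε _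
  have hdiff : ‖rinner A (∑ i, P i (x i)) (∑ i, P i (x i)) -
      ∑ i, absSq (rinner A (y i) (x i))‖ ≤ n * ε := by
    rw [hP.rinner_sum_self, ← Finset.sum_sub_distrib]
    refine (norm_sum_le _ _).trans ?_
    calc _ ≤ ∑ _i : Fin n, ε := Finset.sum_le_sum fun i _ => by
          rw [rinner_normalize_left, ← (hP.isProj i).rinner_map_map_self]
          exact norm_sub_absSq_cfcₙ_truncInvSqrt_mul_le hε (rinner_self_nonneg _)
      _ = n * ε := by simp
  calc _ = ‖rinner A (∑ i, P i (x i)) (∑ i, P i (x i))‖ := (norm_rinner_self _).symm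
    _ ≤ ‖∑ i, absSq (rinner A (y i) (x i))‖ + n * ε := norm_le_norm_add_const_of_dist_le
      (by rwa [dist_eq_norm])
    _ ≤ starNorm A x ^ 2 + n * ε := by gcongr; exact norm_sum_absSq_le_starNorm_sq hmu x

theorem hilbertMultiNorm_le_starNorm (x : Fin n → E) :
    hilbertMultiNorm Aᵐᵒᵖ x ≤ starNorm A x := by
  refine Real.sSup_le ?_ (starNorm_nonneg x)
  rintro _ ⟨P, hP, rfl⟩
  refine (pow_le_pow_iff_left₀ (norm_nonneg _) (starNorm_nonneg x) two_ne_zero).1 ?_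
  have hlim : Filter.Tendsto (fun ε : ℝ => starNorm A x ^ 2 + n * ε)
      (nhdsWithin 0 (Set.Ioi 0)) (nhds (starNorm A x ^ 2)) :=
    tendsto_nhdsWithin_of_tendsto_nhds (Continuous.tendsto' (by fun_prop) _ _ (by simp))
  exact ge_of_tendsto hlim (Filter.eventually_of_mem self_mem_nhdsWithin
    fun ε hε => hP.norm_sum_sq_le x hε)

end Projections

section NonnegOfNorm

lemma exists_strongDual_comp_eq {𝕜 X Y : Type*} [RCLike 𝕜] [NormedAddCommGroup X]
    [NormedSpace 𝕜 X] [SeminormedAddCommGroup Y] [NormedSpace 𝕜 Y] (ι : X →ₗᵢ[𝕜] Y)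
    (f : StrongDual 𝕜 X) : ∃ g : StrongDual 𝕜 Y, ‖g‖ ≤ ‖f‖ ∧ ∀ x, g (ι x) = f x := by
  obtain ⟨g, hg, hgn⟩ := exists_extension_norm_eq ι.range
    (f ∘L ι.equivRange.symm.toLinearIsometry.toContinuousLinearMap)
  refine ⟨g, hgn.trans_le ?_, fun x => ?_⟩
  · refine ContinuousLinearMap.opNorm_le_bound _ (norm_nonneg _) fun x => ?_
    exact (f.le_opNorm _).trans_eq (by simp)
  · simpa using hg (ι.equivRange x)

section Unital

variable {B : Type*} [CStarAlgebra B]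

lemma norm_add_smul_I_sq_le {h : B} (hh : IsSelfAdjoint h) (N : ℝ) :
    ‖h + ((N : ℂ) * Complex.I) • (1 : B)‖ ^ 2 ≤ ‖h‖ ^ 2 + N ^ 2 := by
  have hstar : star (h + ((N : ℂ) * Complex.I) • (1 : B)) * (h + ((N : ℂ) * Complex.I) • (1 : B)) =
      h * h + ((N : ℂ) ^ 2) • (1 : B) := by
    have hN : (N : ℂ) ^ 2 = ((N : ℂ) * Complex.I) * ((N : ℂ) * -Complex.I) := by
      linear_combination (N : ℂ) ^ 2 * Complex.I_sq
    simp only [star_add, hh.star_eq, star_smul, star_one, star_mul', RCLike.star_def,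
      Complex.conj_ofReal, Complex.conj_I, add_mul, mul_add, smul_mul_assoc, mul_smul_comm,
      mul_one, one_mul, hN]
    module
  rw [sq, ← CStarRing.norm_star_mul_self, hstar]
  refine (norm_add_le _ _).trans (add_le_add ?_ ?_)
  · exact (norm_mul_le _ _).trans_eq (sq _).symm
  · rw [norm_smul, norm_pow, Complex.norm_real, Real.norm_eq_abs, sq_abs]
    exact mul_le_of_le_one_right (sq_nonneg N) (IsStarProjection.one B).norm_le

lemma im_apply_eq_zero_of_isSelfAdjoint {g : StrongDual ℂ B} (hg : ‖g‖ ≤ 1) (hg1 : g 1 = 1)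
    {h : B} (hh : IsSelfAdjoint h) : (g h).im = 0 := by
  have hquad (N : ℝ) : (g h).im ^ 2 + 2 * N * (g h).im ≤ ‖h‖ ^ 2 := by
    have hle : ‖g (h + ((N : ℂ) * Complex.I) • (1 : B))‖ ^ 2 ≤ ‖h‖ ^ 2 + N ^ 2 :=
      (pow_le_pow_left₀ (norm_nonneg _) (g.le_of_opNorm_le_of_le hg le_rfl) 2).trans
        (by simpa using norm_add_smul_I_sq_le hh N)
    have him := (Complex.abs_im_le_norm (g (h + ((N : ℂ) * Complex.I) • (1 : B))))
    rw [← sq_le_sq₀ (abs_nonneg _) (norm_nonneg _), sq_abs] at him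
    have hval : (g (h + ((N : ℂ) * Complex.I) • (1 : B))).im = (g h).im + N := by
      simp [hg1]
    rw [hval] at him
    linarith
  by_contra hne
  have hN := hquad (‖h‖ ^ 2 / (g h).im)
  rw [mul_assoc, div_mul_cancel₀ _ hne] at hN
  linarith [pow_pos (abs_pos.2 hne) 2, sq_abs (g h).im, sq_nonneg ‖h‖]

variable [PartialOrder B] [StarOrderedRing B]

lemma norm_two_smul_sub_algebraMap_le {a : B} (ha : 0 ≤ a) {r : ℝ} (har : ‖a‖ ≤ r) :
    ‖(2 : ℝ) • a - algebraMap ℝ B r‖ ≤ r := by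
  have hcfc : (2 : ℝ) • a - algebraMap ℝ B r = cfc (fun t : ℝ => 2 * t - r) a := by
    rw [cfc_sub (fun t : ℝ => 2 * t) (fun _ => r) a, cfc_const_mul 2 (fun t : ℝ => t) a,
      cfc_id' ℝ a, cfc_const r a]
  rw [hcfc]
  refine norm_cfc_le ((norm_nonneg a).trans har) fun t ht => ?_
  have ht₀ : 0 ≤ t := spectrum_nonneg_of_nonneg ha ht
  have htr : t ≤ r :=
    ((le_algebraMap_iff_spectrum_le ha.isSelfAdjoint).1
      ha.isSelfAdjoint.le_algebraMap_norm_self t ht).trans har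
  rw [Real.norm_eq_abs, abs_le]
  constructor <;> linarith

lemma norm_two_mul_apply_sub_le {g : StrongDual ℂ B} (hg : ‖g‖ ≤ 1) {a : B} (ha : 0 ≤ a) {r : ℝ}
    (har : ‖a‖ ≤ r) : ‖2 * g a - r * g 1‖ ≤ r := by
  have hval : g ((2 : ℝ) • a - algebraMap ℝ B r) = 2 * g a - r * g 1 := by
    rw [map_sub, Algebra.algebraMap_eq_smul_one, ← Complex.coe_smul, ← Complex.coe_smul, map_smul,
      map_smul, smul_eq_mul, smul_eq_mul, Complex.ofReal_ofNat]
  rw [← hval]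
  simpa using g.le_of_opNorm_le_of_le hg (norm_two_smul_sub_algebraMap_le ha har)

lemma apply_one_eq_one_of_apply_eq_one {g : StrongDual ℂ B} (hg : ‖g‖ ≤ 1) {a : B} (ha : 0 ≤ a)
    (ha1 : ‖a‖ ≤ 1) (hga : g a = 1) : g 1 = 1 := by
  have hone : ‖g 1‖ ≤ 1 := by
    simpa using g.le_of_opNorm_le_of_le hg (IsStarProjection.one B).norm_le
  have htwo : ‖2 - g 1‖ ≤ 1 := by simpa [hga] using norm_two_mul_apply_sub_le hg ha ha1
  -- The closed unit discs around `0` and `2` meet only in `1`.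
  have hlaw := parallelogram_law_with_norm ℝ (1 : ℂ) (g 1 - 1)
  rw [add_sub_cancel, sub_sub_eq_add_sub, one_add_one_eq_two, norm_one] at hlaw
  have hdist : ‖g 1 - 1‖ = 0 := by nlinarith [norm_nonneg (g 1), norm_nonneg (2 - g 1)]
  exact sub_eq_zero.1 (norm_eq_zero.1 hdist)

lemma apply_nonneg_of_apply_one_eq_one {g : StrongDual ℂ B} (hg : ‖g‖ ≤ 1) (hg1 : g 1 = 1)
    {b : B} (hb : 0 ≤ b) : 0 ≤ g b := by
  rw [Complex.nonneg_iff, im_apply_eq_zero_of_isSelfAdjoint hg hg1 hb.isSelfAdjoint]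
  refine ⟨?_, rfl⟩
  have hre := neg_le_of_abs_le
    ((Complex.abs_re_le_norm _).trans (norm_two_mul_apply_sub_le hg hb le_rfl))
  simp only [hg1, mul_one, Complex.sub_re, Complex.mul_re, Complex.re_ofNat, Complex.im_ofNat,
    zero_mul, sub_zero, Complex.ofReal_re] at hre
  linarith

end Unital

lemma apply_nonneg_of_apply_eq_one {A : Type*} [NonUnitalCStarAlgebra A] [PartialOrder A]
    [StarOrderedRing A] {f : StrongDual ℂ A} (hf : ‖f‖ ≤ 1) {a : A} (ha : 0 ≤ a) (ha1 : ‖a‖ ≤ 1)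
    (hfa : f a = 1) {b : A} (hb : 0 ≤ b) : 0 ≤ f b := by
  let ι : A →ₗᵢ[ℂ] Unitization ℂ A :=
    { toLinearMap := Unitization.inrHom ℂ ℂ A
      norm_map' := fun a => Unitization.norm_inr (𝕜 := ℂ) a }
  obtain ⟨g, hgf, hg⟩ := exists_strongDual_comp_eq ι f
  have hg1 : g 1 = 1 := apply_one_eq_one_of_apply_eq_one (hgf.trans hf)
    (Unitization.inr_nonneg_iff.2 ha) ((ι.norm_map a).trans_le ha1) ((hg a).trans hfa)
  exact (hg b).symm ▸
    apply_nonneg_of_apply_one_eq_one (hgf.trans hf) hg1 (Unitization.inr_nonneg_iff.2 hb)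

end NonnegOfNorm

section PositiveFunctionals

variable {A : Type*} [NonUnitalCStarAlgebra A] [PartialOrder A]

lemma ofReal_re_apply_of_nonneg (τ : A →ₚ[ℂ] ℂ) {a : A} (ha : 0 ≤ a) :
    (((τ a).re : ℝ) : ℂ) = τ a :=
  (Complex.eq_re_of_ofReal_le (τ.map_nonneg ha)).symm

lemma re_apply_nonneg (τ : A →ₚ[ℂ] ℂ) {a : A} (ha : 0 ≤ a) : 0 ≤ (τ a).re :=
  (Complex.nonneg_iff.1 (τ.map_nonneg ha)).1

variable [StarOrderedRing A]

lemma mul_le_self_of_commute {a b : A} (ha : 0 ≤ a) (hb : 0 ≤ b) (hb1 : ‖b‖ ≤ 1)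
    (hab : Commute a b) : a * b ≤ a := by
  have hsqrt : star (CFC.sqrt a) * CFC.sqrt a = a := by
    rw [(CFC.sqrt_nonneg a).isSelfAdjoint.star_eq, CFC.sqrt_mul_sqrt_self a ha]
  calc a * b = star (CFC.sqrt a) * b * CFC.sqrt a := by
        have hcomm : Commute (CFC.sqrt a) b := hab.cfcₙ_nnreal NNReal.sqrt
        rw [mul_assoc, ← hcomm.eq, ← mul_assoc, hsqrt]
    _ ≤ ‖b‖ • (star (CFC.sqrt a) * CFC.sqrt a) :=
      CStarAlgebra.star_left_conjugate_le_norm_smul hb.isSelfAdjoint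
    _ ≤ (1 : ℝ) • a := by rw [hsqrt]; exact smul_le_smul_of_nonneg_right hb1 ha
    _ = a := one_smul _ _

lemma toDual_apply (τ : A →ₚ[ℂ] ℂ) (a : A) : toDual τ a = τ a := rfl

lemma re_apply_le_norm (τ : A →ₚ[ℂ] ℂ) (a : A) : (τ a).re ≤ ‖toDual τ‖ * ‖a‖ :=
  (Complex.re_le_norm _).trans ((toDual τ).le_opNorm a)

lemma norm_apply_star_mul_sq_le (τ : A →ₚ[ℂ] ℂ) (a b : A) :
    ‖τ (star a * b)‖ ^ 2 ≤ (τ (star a * a)).re * (τ (star b * b)).re := by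
  have hnorm (c : A) : ‖τ.toPreGNS c‖ ^ 2 = (τ (star c * c)).re := by
    rw [PositiveLinearMap.preGNS_norm_def]
    exact Real.sq_sqrt (re_apply_nonneg τ (star_mul_self_nonneg _))
  rw [← hnorm, ← hnorm, ← mul_pow]
  exact pow_le_pow_left₀ (norm_nonneg _)
    (norm_inner_le_norm (𝕜 := ℂ) (τ.toPreGNS a) (τ.toPreGNS b)) 2

lemma norm_apply_mul_sq_le (τ : A →ₚ[ℂ] ℂ) {e : A} (he : 0 ≤ e) (he1 : ‖e‖ ≤ 1) (x : A) :
    ‖τ (e * x)‖ ^ 2 ≤ (τ e).re * (‖toDual τ‖ * ‖x‖ ^ 2) := by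
  calc ‖τ (e * x)‖ ^ 2 = ‖τ (star e * x)‖ ^ 2 := by rw [he.isSelfAdjoint.star_eq]
    _ ≤ (τ (star e * e)).re * (τ (star x * x)).re := norm_apply_star_mul_sq_le τ e x
    _ ≤ (τ e).re * (‖toDual τ‖ * ‖x‖ ^ 2) := by
      gcongr
      · exact re_apply_nonneg τ (star_mul_self_nonneg x)
      · exact re_apply_nonneg τ he
      · rw [he.isSelfAdjoint.star_eq]
        exact mul_le_self_of_commute he he he1 (Commute.refl e)
      · simpa [CStarRing.norm_star_mul_self, sq] using re_apply_le_norm τ (star x * x)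

lemma tendsto_apply_approximateUnit_mul (τ : A →ₚ[ℂ] ℂ) (x : A) :
    Filter.Tendsto (fun e => τ (e * x)) (CStarAlgebra.approximateUnit A) (nhds (τ x)) :=
  ((map_continuous τ).tendsto x).comp
    ((CStarAlgebra.increasingApproximateUnit A).tendsto_mul_right x)

lemma tendsto_re_apply_approximateUnit (τ : A →ₚ[ℂ] ℂ) :
    Filter.Tendsto (fun e => (τ e).re) (CStarAlgebra.approximateUnit A) (nhds ‖toDual τ‖) := by
  have hunit := CStarAlgebra.increasingApproximateUnit A
  rw [tendsto_order]
  constructor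
  · intro c hc
    rcases lt_or_ge c 0 with hc₀ | hc₀
    · filter_upwards [hunit.eventually_nonneg] with e he
      exact hc₀.trans_le (re_apply_nonneg τ he)
    have hpos : 0 < ‖toDual τ‖ := hc₀.trans_lt hc
    obtain ⟨x, hx, hxc⟩ := (toDual τ).exists_lt_apply_of_lt_opNorm (r := √(c * ‖toDual τ‖)) <|
      (Real.sqrt_lt' hpos).2 (by rw [sq]; gcongr)
    rw [Real.sqrt_lt' ((Real.sqrt_nonneg _).trans_lt hxc), toDual_apply] at hxc
    have heventually :=
      ((tendsto_apply_approximateUnit_mul τ x).norm.pow 2).eventually_const_lt hxc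
    filter_upwards [hunit.eventually_nonneg, hunit.eventually_norm, heventually] with e he he1 hlt
    refine lt_of_mul_lt_mul_right (hlt.trans_le ?_) hpos.le
    refine (norm_apply_mul_sq_le τ he he1 x).trans ?_
    have hre := re_apply_nonneg τ he
    gcongr
    exact mul_le_of_le_one_right hpos.le (pow_le_one₀ (norm_nonneg _) hx.le)
  · intro c hc
    filter_upwards [hunit.eventually_norm] with e he
    exact ((re_apply_le_norm τ e).trans (mul_le_of_le_one_right (norm_nonneg _) he)).trans_lt hc

lemma tendsto_apply_approximateUnit (τ : A →ₚ[ℂ] ℂ) :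
    Filter.Tendsto τ (CStarAlgebra.approximateUnit A) (nhds (‖toDual τ‖ : ℂ)) := by
  refine ((Complex.continuous_ofReal.tendsto _).comp (tendsto_re_apply_approximateUnit τ)).congr' ?_
  filter_upwards [(CStarAlgebra.increasingApproximateUnit A).eventually_nonneg] with e he
  exact ofReal_re_apply_of_nonneg τ he

lemma norm_toDual_add (ρ σ : A →ₚ[ℂ] ℂ) : ‖toDual (ρ + σ)‖ = ‖toDual ρ‖ + ‖toDual σ‖ :=
  tendsto_nhds_unique (tendsto_re_apply_approximateUnit (ρ + σ)) <| by
    simpa using (tendsto_re_apply_approximateUnit ρ).add (tendsto_re_apply_approximateUnit σ)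

end PositiveFunctionals

section SupportingFunctionals

variable {𝕜 X : Type*} [RCLike 𝕜] [NormedAddCommGroup X] [NormedSpace 𝕜 X]

variable (𝕜) in
/-- The functionals in the dual unit ball that take the value `1` at `b`. When `‖b‖ ≤ 1` this is a
weak⋆ closed face of the ball. -/
def supportingFunctionals (b : X) : Set (StrongDual 𝕜 X) := {f | ‖f‖ ≤ 1 ∧ f b = 1}

lemma isCompact_preimage_supportingFunctionals (b : X) :
    IsCompact (WeakDual.toStrongDual ⁻¹' supportingFunctionals 𝕜 b) := by
  have hset : WeakDual.toStrongDual ⁻¹' supportingFunctionals 𝕜 b =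
      WeakDual.toStrongDual ⁻¹' Metric.closedBall (0 : StrongDual 𝕜 X) 1 ∩ {f | f b = 1} := by
    ext f
    simp only [supportingFunctionals, Set.mem_preimage, Set.mem_inter_iff, mem_closedBall_zero_iff,
      Set.mem_ofPred_eq, WeakDual.toStrongDual_apply]
  rw [hset]
  exact (WeakDual.isCompact_closedBall 0 1).inter_right
    (isClosed_singleton.preimage (WeakDual.eval_continuous b))

lemma extremePoints_supportingFunctionals_nonempty {b : X} (hb : ‖b‖ = 1) :
    (Set.extremePoints ℝ (supportingFunctionals 𝕜 b)).Nonempty := by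
  have : LocallyConvexSpace ℝ (WeakDual 𝕜 X) :=
    inferInstanceAs (LocallyConvexSpace ℝ (WeakBilin (topDualPairing 𝕜 X)))
  obtain ⟨g, hg, hgb⟩ := exists_dual_vector'' 𝕜 b
  have hne : (WeakDual.toStrongDual ⁻¹' supportingFunctionals 𝕜 b).Nonempty :=
    ⟨StrongDual.toWeakDual g, hg, by simpa [hb] using hgb⟩
  obtain ⟨f, hf⟩ := (isCompact_preimage_supportingFunctionals b).extremePoints_nonempty hne
  exact ⟨WeakDual.toStrongDual f, hf⟩

end SupportingFunctionals

section PureStates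

variable {A : Type*} [NonUnitalCStarAlgebra A] [PartialOrder A] [StarOrderedRing A]

lemma exists_toDual_eq_smul_supportingFunctional {a : A} (ha : 0 ≤ a)
    (hne : (supportingFunctionals ℂ a).Nonempty) {κ : A →ₚ[ℂ] ℂ} (hκ : (κ a).re = ‖toDual κ‖) :
    ∃ f ∈ supportingFunctionals ℂ a, toDual κ = ‖toDual κ‖ • f := by
  rcases eq_or_ne ‖toDual κ‖ 0 with h₀ | h₀
  · obtain ⟨f, hf⟩ := hne
    exact ⟨f, hf, by rw [h₀, norm_eq_zero.1 h₀]; exact (zero_smul ℝ f).symm⟩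
  · refine ⟨‖toDual κ‖⁻¹ • toDual κ, ⟨by simp [norm_smul, h₀], ?_⟩, by rw [smul_inv_smul₀ h₀]⟩
    rw [smul_apply, toDual_apply, ← ofReal_re_apply_of_nonneg κ ha, hκ,
      Complex.real_smul, ← Complex.ofReal_mul, inv_mul_cancel₀ h₀, Complex.ofReal_one]

lemma re_apply_eq_norm_of_add {a : A} (ha1 : ‖a‖ ≤ 1) {ρ σ : A →ₚ[ℂ] ℂ}
    (h : ((ρ + σ) a).re = ‖toDual (ρ + σ)‖) :
    (ρ a).re = ‖toDual ρ‖ ∧ (σ a).re = ‖toDual σ‖ := by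
  have hle (κ : A →ₚ[ℂ] ℂ) : (κ a).re ≤ ‖toDual κ‖ :=
    (re_apply_le_norm κ a).trans (mul_le_of_le_one_right (norm_nonneg _) ha1)
  rw [norm_toDual_add, PositiveLinearMap.add_apply, Complex.add_re] at h
  constructor <;> linarith [hle ρ, hle σ]

lemma norm_eq_one_of_mem_supportingFunctionals {X : Type*} [NormedAddCommGroup X] [NormedSpace ℂ X]
    {b : X} (hb : ‖b‖ ≤ 1) {f : StrongDual ℂ X} (hf : f ∈ supportingFunctionals ℂ b) :
    ‖f‖ = 1 := by
  refine le_antisymm hf.1 ?_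
  have hle := f.le_of_opNorm_le_of_le le_rfl hb
  rwa [hf.2, norm_one, mul_one] at hle

lemma isPureState_of_toDual_mem_extremePoints {a : A} (ha : 0 ≤ a) (ha1 : ‖a‖ ≤ 1)
    {τ : A →ₚ[ℂ] ℂ} (hτ : toDual τ ∈ Set.extremePoints ℝ (supportingFunctionals ℂ a)) :
    IsPureState τ := by
  obtain ⟨hτmem, hext⟩ := mem_extremePoints_iff_forall_segment.1 hτ
  have hτ1 : ‖toDual τ‖ = 1 := norm_eq_one_of_mem_supportingFunctionals ha1 hτmem
  have hτa : (τ a).re = ‖toDual τ‖ := by rw [hτ1, ← toDual_apply, hτmem.2, Complex.one_re]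
  refine ⟨hτ1, fun ρ hρ => ?_⟩
  obtain ⟨σ, rfl⟩ : ∃ σ, ρ + σ = τ :=
    ⟨PositiveLinearMap.mk₀ (τ.toLinearMap - ρ.toLinearMap) fun b hb => by simpa using hρ b hb,
      PositiveLinearMap.ext fun b => add_sub_cancel (ρ b) (τ b)⟩
  obtain ⟨hρa, hσa⟩ := re_apply_eq_norm_of_add ha1 hτa
  obtain ⟨f, hf, hρf⟩ := exists_toDual_eq_smul_supportingFunctional ha ⟨_, hτmem⟩ hρa
  obtain ⟨g, hg, hσg⟩ := exists_toDual_eq_smul_supportingFunctional ha ⟨_, hτmem⟩ hσa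
  rw [norm_toDual_add] at hτ1
  have hsum : toDual (ρ + σ) = toDual ρ + toDual σ := rfl
  have hseg : toDual (ρ + σ) ∈ segment ℝ f g :=
    ⟨_, _, norm_nonneg _, norm_nonneg _, hτ1, by rw [← hρf, ← hσg, hsum]⟩
  have hρ_eq : toDual ρ = ‖toDual ρ‖ • toDual (ρ + σ) := by
    rcases hext f hf g hg hseg with rfl | rfl
    · exact hρf
    · rw [eq_sub_of_add_eq hτ1, sub_smul (1 : ℝ) ‖toDual σ‖ (toDual (ρ + σ)), ← hσg, one_smul, hsum,
        add_sub_cancel_right]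
  refine ⟨‖toDual ρ‖, norm_nonneg _, by linarith [norm_nonneg (toDual σ)], fun b => ?_⟩
  exact DFunLike.congr_fun hρ_eq b

theorem exists_pureState_apply_eq_norm {a : A} (ha : 0 ≤ a) (ha₀ : a ≠ 0) :
    ∃ τ : PureState A, τ.1 a = ‖a‖ := by
  have hnorm : (‖a‖ : ℂ) ≠ 0 := by simpa using ha₀
  set b : A := (‖a‖⁻¹ : ℝ) • a with hb
  have hb₀ : 0 ≤ b := smul_nonneg (by positivity) ha
  have hb1 : ‖b‖ = 1 := by simp [hb, norm_smul, ha₀]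
  obtain ⟨f, hf⟩ := extremePoints_supportingFunctionals_nonempty (𝕜 := ℂ) hb1
  let τ : A →ₚ[ℂ] ℂ := PositiveLinearMap.mk₀ f.toLinearMap fun c hc =>
    apply_nonneg_of_apply_eq_one hf.1.1 hb₀ hb1.le hf.1.2 hc
  refine ⟨⟨τ, isPureState_of_toDual_mem_extremePoints (τ := τ) hb₀ hb1.le hf⟩, ?_⟩
  have hτb : τ b = 1 := hf.1.2
  rw [hb, ← Complex.coe_smul, map_smul, smul_eq_mul, Complex.ofReal_inv] at hτb
  exact (inv_mul_eq_one₀ hnorm).1 hτb |>.symm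

end PureStates

section HilbertSpace

lemma IsProj.norm_apply_le {H : Type*} [SeminormedAddCommGroup H] [InnerProductSpace ℂ H]
    {P : H → H} (hP : IsProj ℂ P) (x : H) : ‖P x‖ ≤ ‖x‖ := by
  have hsq : ‖P x‖ ^ 2 ≤ ‖x‖ * ‖P x‖ := by
    rw [← inner_self_eq_norm_sq (𝕜 := ℂ), hP.selfAdjoint, hP.idempotent]
    exact (RCLike.re_le_norm _).trans (norm_inner_le_norm _ _)
  nlinarith [norm_nonneg (P x), norm_nonneg x]

lemma hilbertMultiNorm_nonneg {R E : Type*} [NormedAddCommGroup E] [Inner R E] {n : ℕ}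
    (x : Fin n → E) : 0 ≤ hilbertMultiNorm R x :=
  Real.sSup_nonneg (by rintro _ ⟨P, -, rfl⟩; exact norm_nonneg _)

variable {H : Type*} [NormedAddCommGroup H] [InnerProductSpace ℂ H] {n : ℕ}

lemma IsProjFamily.norm_sum_apply_le {P : Fin n → H → H} (hP : IsProjFamily ℂ P)
    (x : Fin n → H) : ‖∑ i, P i (x i)‖ ≤ ∑ i, ‖x i‖ :=
  norm_sum_le_of_le _ fun i _ => (hP.isProj i).norm_apply_le (x i)

lemma IsProjFamily.norm_sum_apply_le_hilbertMultiNorm {P : Fin n → H → H}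
    (hP : IsProjFamily ℂ P) (x : Fin n → H) : ‖∑ i, P i (x i)‖ ≤ hilbertMultiNorm ℂ x := by
  refine le_csSup ⟨∑ i, ‖x i‖, ?_⟩ ⟨P, hP, rfl⟩
  rintro _ ⟨Q, hQ, rfl⟩
  exact hQ.norm_sum_apply_le x

lemma hilbertMultiNorm_le_sum_norm (x : Fin n → H) : hilbertMultiNorm ℂ x ≤ ∑ i, ‖x i‖ := by
  refine Real.sSup_le ?_ (by positivity)
  rintro _ ⟨P, hP, rfl⟩
  exact hP.norm_sum_apply_le x

end HilbertSpace

section GNS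

variable {A E : Type*} [NonUnitalCStarAlgebra A] [PartialOrder A] [StarOrderedRing A]
  [NormedAddCommGroup E] [NormedSpace ℂ E] [SMul Aᵐᵒᵖ E] [CStarModule Aᵐᵒᵖ E] {n : ℕ}

lemma norm_gnsClass_sq (τ : A →ₚ[ℂ] ℂ) (x : E) :
    ‖gnsClass τ x‖ ^ 2 = (τ (rinner A x x)).re := by
  rw [← inner_self_eq_norm_sq (𝕜 := ℂ), gnsClass_inner, RCLike.re_to_complex]

lemma norm_gnsClass_le (τ : PureState A) (x : E) : ‖gnsClass τ.1 x‖ ≤ ‖x‖ := by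
  refine (pow_le_pow_iff_left₀ (norm_nonneg _) (norm_nonneg _) two_ne_zero).1 ?_
  rw [norm_gnsClass_sq, ← norm_rinner_self (A := A)]
  simpa [τ.2.norm_eq_one] using re_apply_le_norm τ.1 (rinner A x x)

lemma pureNorm_nonneg (x : Fin n → E) : 0 ≤ pureNorm A x :=
  Real.iSup_nonneg fun _ => hilbertMultiNorm_nonneg _

lemma hilbertMultiNorm_gnsClass_le_pureNorm (τ : PureState A) (x : Fin n → E) :
    hilbertMultiNorm ℂ (fun i => gnsClass τ.1 (x i)) ≤ pureNorm A x := by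
  refine le_ciSup (f := fun τ : PureState A => hilbertMultiNorm ℂ (fun i => gnsClass τ.1 (x i)))
    ⟨∑ i, ‖x i‖, ?_⟩ τ
  rintro _ ⟨σ, rfl⟩
  exact (hilbertMultiNorm_le_sum_norm _).trans
    (Finset.sum_le_sum fun i _ => norm_gnsClass_le σ (x i))

lemma gnsClass_induction (τ : A →ₚ[ℂ] ℂ) {p : GNSSpace τ E → Prop} (hp : IsClosed {w | p w})
    (h : ∀ x : E, p (gnsClass τ x)) (w : GNSSpace τ E) : p w :=
  UniformSpace.Completion.induction_on w hp h

variable (E) in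
/-- The map `x ↦ x + N_τ` as a linear map. -/
def gnsClassₗ (τ : A →ₚ[ℂ] ℂ) : E →ₗ[ℂ] GNSSpace τ E :=
  (UniformSpace.Completion.toComplL (𝕜 := ℂ) (E := PreGNS τ E)).toLinearMap ∘ₗ
    (toPreGNS τ E).toLinearMap

lemma gnsClass_sum (τ : A →ₚ[ℂ] ℂ) {ι : Type*} (s : Finset ι) (x : ι → E) :
    gnsClass τ (∑ i ∈ s, x i) = ∑ i ∈ s, gnsClass τ (x i) :=
  map_sum (gnsClassₗ E τ) x s

lemma gnsClass_zero (τ : A →ₚ[ℂ] ℂ) : gnsClass τ (0 : E) = 0 :=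
  map_zero (gnsClassₗ E τ)

lemma IsProj.preGNS (τ : A →ₚ[ℂ] ℂ) {P : E → E} (hP : IsProj Aᵐᵒᵖ P) :
    IsProj ℂ fun v : PreGNS τ E => toPreGNS τ E (P ((toPreGNS τ E).symm v)) where
  selfAdjoint v w :=
    congrArg τ (hP.rinner_left ((toPreGNS τ E).symm v) ((toPreGNS τ E).symm w))
  idempotent v := congrArg (toPreGNS τ E) (hP.idempotent ((toPreGNS τ E).symm v))

/-- The bounded operator that a projection on `E` induces on `E` with the seminorm of `τ`. -/
def IsProj.preGNSMap (τ : A →ₚ[ℂ] ℂ) {P : E → E} (hP : IsProj Aᵐᵒᵖ P) :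
    PreGNS τ E →L[ℂ] PreGNS τ E :=
  LinearMap.mkContinuous
    { toFun := fun v => toPreGNS τ E (P ((toPreGNS τ E).symm v))
      map_add' := fun v w => by simp [hP.map_add]
      map_smul' := fun c v => by simp [hP.map_smul] } 1 fun v => by
    simpa using (hP.preGNS τ).norm_apply_le v

/-- The operator on `H_τ` induced by a projection `P` on `E`: the continuous extension of
`x + N_τ ↦ P x + N_τ`. -/
def IsProj.gnsMap (τ : A →ₚ[ℂ] ℂ) {P : E → E} (hP : IsProj Aᵐᵒᵖ P) :
    GNSSpace τ E →L[ℂ] GNSSpace τ E :=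
  (hP.preGNSMap τ).completion

lemma IsProj.gnsMap_gnsClass (τ : A →ₚ[ℂ] ℂ) {P : E → E} (hP : IsProj Aᵐᵒᵖ P) (x : E) :
    hP.gnsMap τ (gnsClass τ x) = gnsClass τ (P x) :=
  UniformSpace.Completion.map_coe (hP.preGNSMap τ).uniformContinuous _

lemma IsProj.isProj_gnsMap (τ : A →ₚ[ℂ] ℂ) {P : E → E} (hP : IsProj Aᵐᵒᵖ P) :
    IsProj ℂ (hP.gnsMap τ) where
  selfAdjoint v w := by
    induction v using gnsClass_induction with
    | hp => exact isClosed_eq (by fun_prop) (by fun_prop)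
    | h x =>
      induction w using gnsClass_induction with
      | hp => exact isClosed_eq (by fun_prop) (by fun_prop)
      | h y => simp only [gnsMap_gnsClass, gnsClass_inner, hP.rinner_left]
  idempotent v := by
    induction v using gnsClass_induction with
    | hp => exact isClosed_eq (by fun_prop) (by fun_prop)
    | h x => simp only [gnsMap_gnsClass, hP.idempotent]

lemma IsProjFamily.isProjFamily_gnsMap (τ : A →ₚ[ℂ] ℂ) {P : Fin n → E → E}
    (hP : IsProjFamily Aᵐᵒᵖ P) : IsProjFamily ℂ fun i => ⇑((hP.isProj i).gnsMap τ) where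
  isProj i := (hP.isProj i).isProj_gnsMap τ
  orthogonal i j hij v := by
    induction v using gnsClass_induction with
    | hp => exact isClosed_eq (by fun_prop) (by fun_prop)
    | h x => rw [IsProj.gnsMap_gnsClass, IsProj.gnsMap_gnsClass, hP.orthogonal i j hij,
        gnsClass_zero]
  sum_eq v := by
    induction v using gnsClass_induction with
    | hp => exact isClosed_eq (by fun_prop) (by fun_prop)
    | h x => simp only [IsProj.gnsMap_gnsClass, ← gnsClass_sum, hP.sum_eq]

lemma exists_pureState_norm_gnsClass_eq {z : E} (hz : z ≠ 0) :
    ∃ τ : PureState A, ‖gnsClass τ.1 z‖ = ‖z‖ := by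
  have hne : rinner A z z ≠ 0 := by
    rw [← norm_ne_zero_iff, norm_rinner_self]
    exact pow_ne_zero 2 (norm_ne_zero_iff.2 hz)
  obtain ⟨τ, hτ⟩ := exists_pureState_apply_eq_norm (rinner_self_nonneg z) hne
  refine ⟨τ, (pow_left_inj₀ (norm_nonneg _) (norm_nonneg _) two_ne_zero).1 ?_⟩
  rw [norm_gnsClass_sq, hτ, norm_rinner_self, Complex.ofReal_re]

theorem hilbertMultiNorm_le_pureNorm (x : Fin n → E) :
    hilbertMultiNorm Aᵐᵒᵖ x ≤ pureNorm A x := by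
  refine Real.sSup_le ?_ (pureNorm_nonneg x)
  rintro _ ⟨P, hP, rfl⟩
  rcases eq_or_ne (∑ i, P i (x i)) 0 with h₀ | h₀
  · simpa only [h₀, norm_zero] using pureNorm_nonneg x
  obtain ⟨τ, hτ⟩ := exists_pureState_norm_gnsClass_eq (A := A) h₀
  calc ‖∑ i, P i (x i)‖ = ‖∑ i, (hP.isProj i).gnsMap τ.1 (gnsClass τ.1 (x i))‖ := by
        simp only [← hτ, gnsClass_sum, IsProj.gnsMap_gnsClass]
    _ ≤ hilbertMultiNorm ℂ fun i => gnsClass τ.1 (x i) :=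
        (hP.isProjFamily_gnsMap τ.1).norm_sum_apply_le_hilbertMultiNorm _
    _ ≤ pureNorm A x := hilbertMultiNorm_gnsClass_le_pureNorm τ x

end GNS

section OrthonormalProj

variable {H : Type*} [NormedAddCommGroup H] [InnerProductSpace ℂ H] {n : ℕ}

/-- The orthogonal projection onto the line of `g i`, enlarged for `i = i₀` by the orthogonal
complement of all of `g`, so that for orthonormal `g` the projections sum to the identity. -/
def orthonormalProj (g : Fin n → H) (i₀ i : Fin n) (w : H) : H :=
  inner ℂ (g i) w • g i + if i = i₀ then w - ∑ j, inner ℂ (g j) w • g j else 0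

lemma inner_orthonormalProj {g : Fin n → H} (hg : Orthonormal ℂ g) (i₀ i j : Fin n) (w : H) :
    inner ℂ (g j) (orthonormalProj g i₀ i w) = if j = i then inner ℂ (g j) w else 0 := by
  have hresidual : inner ℂ (g j) (w - ∑ k, inner ℂ (g k) w • g k) = 0 := by
    rw [inner_sub_right, hg.inner_right_fintype, sub_self]
  have hline : inner ℂ (g j) (inner ℂ (g i) w • g i) = if j = i then inner ℂ (g j) w else 0 := by
    rw [inner_smul_right, orthonormal_iff_ite.1 hg]
    split_ifs with h <;> simp [h]
  rw [orthonormalProj, inner_add_right, hline]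
  split_ifs <;> simp [hresidual]

lemma isAdjoint_orthonormalProj (g : Fin n → H) (i₀ i : Fin n) :
    IsAdjoint ℂ (orthonormalProj g i₀ i) (orthonormalProj g i₀ i) := by
  intro v w
  have hline (j : Fin n) :
      inner ℂ (inner ℂ (g j) v • g j) w = inner ℂ v (inner ℂ (g j) w • g j) := by
    rw [inner_smul_left, inner_smul_right, inner_conj_symm, mul_comm]
  rw [orthonormalProj, orthonormalProj, inner_add_left, inner_add_right, hline]
  split_ifs
  · simp only [inner_sub_left, inner_sub_right, sum_inner, inner_sum, hline]
  · rw [inner_zero_left, inner_zero_right]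

lemma orthonormalProj_orthonormalProj {g : Fin n → H} (hg : Orthonormal ℂ g) (i₀ i j : Fin n)
    (w : H) :
    orthonormalProj g i₀ i (orthonormalProj g i₀ j w) =
      if i = j then orthonormalProj g i₀ i w else 0 := by
  have hsum : ∑ k, inner ℂ (g k) (orthonormalProj g i₀ j w) • g k = inner ℂ (g j) w • g j := by
    simp [inner_orthonormalProj hg]
  rw [orthonormalProj, hsum, inner_orthonormalProj hg]
  rcases eq_or_ne i j with rfl | hij
  · simp only [orthonormalProj, if_true, add_sub_cancel_left]
    split_ifs <;> rfl
  · have hj (hi : i = i₀) : j ≠ i₀ := fun hj => hij (hi.trans hj.symm)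
    simp +contextual [orthonormalProj, hij, hj]

lemma isProjFamily_orthonormalProj {g : Fin n → H} (hg : Orthonormal ℂ g) (i₀ : Fin n) :
    IsProjFamily ℂ (orthonormalProj g i₀) where
  isProj i := ⟨isAdjoint_orthonormalProj g i₀ i, fun w => by
    rw [orthonormalProj_orthonormalProj hg, if_pos rfl]⟩
  orthogonal i j hij w := by rw [orthonormalProj_orthonormalProj hg, if_neg hij]
  sum_eq w := by simp [orthonormalProj, Finset.sum_add_distrib]

lemma sum_norm_inner_sq_le_of_orthonormal {g : Fin n → H} (hg : Orthonormal ℂ g) (x : Fin n → H) :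
    ∑ i, ‖inner ℂ (g i) (x i)‖ ^ 2 ≤ hilbertMultiNorm ℂ x ^ 2 := by
  rcases isEmpty_or_nonempty (Fin n) with _ | ⟨⟨i₀⟩⟩
  · simpa using sq_nonneg _
  calc ∑ i, ‖inner ℂ (g i) (x i)‖ ^ 2
      = ∑ i, ‖inner ℂ (g i) (∑ j, orthonormalProj g i₀ j (x j))‖ ^ 2 := by
        simp only [inner_sum, inner_orthonormalProj hg, Finset.sum_ite_eq, Finset.mem_univ, if_true]
    _ ≤ ‖∑ j, orthonormalProj g i₀ j (x j)‖ ^ 2 := hg.sum_inner_products_le _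
    _ ≤ hilbertMultiNorm ℂ x ^ 2 := by
        gcongr
        exact (isProjFamily_orthonormalProj hg i₀).norm_sum_apply_le_hilbertMultiNorm x

end OrthonormalProj

section PolarDecomposition

open ContinuousLinearMap

variable {V H : Type*} [NormedAddCommGroup V] [InnerProductSpace ℂ V] [CompleteSpace V]
  [NormedAddCommGroup H] [InnerProductSpace ℂ H] [CompleteSpace H]

lemma norm_sqrt_adjoint_comp_self_apply (T : V →L[ℂ] H) (v : V) :
    ‖CFC.sqrt (adjoint T ∘L T) v‖ = ‖T v‖ := by
  set R := CFC.sqrt (adjoint T ∘L T)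
  have hsa : adjoint R = R := (CFC.sqrt_nonneg _).isSelfAdjoint
  have hsq : R (R v) = adjoint T (T v) := DFunLike.congr_fun (CFC.sqrt_mul_sqrt_self _
    ((nonneg_iff_isPositive _).2 (isPositive_adjoint_comp_self T))) v
  refine (pow_left_inj₀ (norm_nonneg _) (norm_nonneg _) two_ne_zero).1 ?_
  rw [← inner_self_eq_norm_sq (𝕜 := ℂ), ← inner_self_eq_norm_sq (𝕜 := ℂ),
    ← adjoint_inner_right, hsa, hsq, adjoint_inner_right]

lemma exists_linearIsometry_comp_sqrt_eq [FiniteDimensional ℂ V] {T : V →L[ℂ] H}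
    (hT : Function.Injective T) :
    ∃ U : V →ₗᵢ[ℂ] H, ∀ v, U (CFC.sqrt (adjoint T ∘L T) v) = T v := by
  have hinj : Function.Injective (CFC.sqrt (adjoint T ∘L T)).toLinearMap := by
    refine (injective_iff_map_eq_zero _).2 fun v hv => ?_
    rwa [coe_coe, ← norm_eq_zero, norm_sqrt_adjoint_comp_self_apply, norm_eq_zero,
      map_eq_zero_iff T hT] at hv
  let R : V ≃ₗ[ℂ] V := LinearEquiv.ofInjectiveEndo _ hinj
  have hR (v : V) : R v = CFC.sqrt (adjoint T ∘L T) v := rfl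
  refine ⟨⟨T.toLinearMap ∘ₗ R.symm.toLinearMap, fun v => ?_⟩, fun v => ?_⟩
  · change ‖T (R.symm v)‖ = ‖v‖
    rw [← norm_sqrt_adjoint_comp_self_apply, ← hR, R.apply_symm_apply]
  · change T (R.symm _) = T v
    rw [← hR, R.symm_apply_apply]

lemma exists_unitary_add_star_eq_two_smul {B : Type*} [CStarAlgebra B] [PartialOrder B]
    [StarOrderedRing B] (a : selfAdjoint B) (ha : ‖a‖ ≤ 1) :
    ∃ W : unitary B, (W : B) + (star W : unitary B) = (2 : ℂ) • (a : B) := by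
  refine ⟨selfAdjoint.unitarySelfAddISMul a ha, ?_⟩
  rw [Unitary.coe_star, selfAdjoint.star_coe_unitarySelfAddISMul,
    selfAdjoint.unitarySelfAddISMul_coe]
  module

lemma exists_add_linearIsometry_eq_two_smul [FiniteDimensional ℂ V] {T : V →L[ℂ] H}
    (hT : Function.Injective T) (hT1 : ‖T‖ ≤ 1) :
    ∃ U₁ U₂ : V →ₗᵢ[ℂ] H, ∀ v, U₁ v + U₂ v = (2 : ℂ) • T v := by
  obtain ⟨U, hU⟩ := exists_linearIsometry_comp_sqrt_eq hT
  have hsqrt : ‖CFC.sqrt (adjoint T ∘L T)‖ ≤ 1 := opNorm_le_bound _ zero_le_one fun v => by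
    rw [norm_sqrt_adjoint_comp_self_apply]
    exact T.le_of_opNorm_le hT1 v
  obtain ⟨W, hW⟩ := exists_unitary_add_star_eq_two_smul
    ⟨CFC.sqrt (adjoint T ∘L T), (CFC.sqrt_nonneg _).isSelfAdjoint⟩ hsqrt
  refine ⟨U.comp (Unitary.linearIsometryEquiv W).toLinearIsometry,
    U.comp (Unitary.linearIsometryEquiv (star W)).toLinearIsometry, fun v => ?_⟩
  have hWv := congrArg U (DFunLike.congr_fun hW v)
  rwa [add_apply, map_add, smul_apply, map_smul, hU] at hWv

end PolarDecomposition

section DenseInjective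

variable {𝕜 V W : Type*} [NontriviallyNormedField 𝕜]

lemma finite_setOf_not_injective_sub_smul [AddCommGroup V] [Module 𝕜 V] [FiniteDimensional 𝕜 V]
    [AddCommGroup W] [Module 𝕜 W] {J : V →ₗ[𝕜] W} (hJ : Function.Injective J) (T : V →ₗ[𝕜] W) :
    {c : 𝕜 | ¬ Function.Injective (T - c • J)}.Finite := by
  obtain ⟨L, hL⟩ := J.exists_leftInverse_of_injective (LinearMap.ker_eq_bot.2 hJ)
  refine (Module.End.finite_hasEigenvalue (L ∘ₗ T)).subset fun c hc => ?_
  obtain ⟨v, hv, hv₀⟩ : ∃ v, (T - c • J) v = 0 ∧ v ≠ 0 := by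
    simpa [injective_iff_map_eq_zero] using hc
  refine Module.End.hasEigenvalue_of_hasEigenvector (x := v)
    ⟨Module.End.mem_eigenspace_iff.2 ?_, hv₀⟩
  have hTv : T v = c • J v := sub_eq_zero.1 hv
  rw [LinearMap.comp_apply, hTv, map_smul, ← LinearMap.comp_apply, hL, LinearMap.id_apply]

lemma dense_setOf_injective [NormedAddCommGroup V] [NormedSpace 𝕜 V] [FiniteDimensional 𝕜 V]
    [NormedAddCommGroup W] [NormedSpace 𝕜 W] {J : V →L[𝕜] W} (hJ : Function.Injective J) :
    Dense {T : V →L[𝕜] W | Function.Injective T} := by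
  intro T
  have hfin := finite_setOf_not_injective_sub_smul (J := J.toLinearMap) hJ T.toLinearMap
  have hcont : Continuous fun c : 𝕜 => T - c • J := by fun_prop
  have hzero : (0 : 𝕜) ∈ closure {c : 𝕜 | Function.Injective (T - c • J)} := by
    refine closure_mono (fun c hc => ?_) (dense_univ.sdiff_finite hfin (0 : 𝕜))
    exact not_not.1 hc.2
  simpa using map_mem_closure hcont hzero fun c hc => hc

end DenseInjective

section ContractiveFamilies

variable {H : Type*} [NormedAddCommGroup H] [InnerProductSpace ℂ H] {n : ℕ}

section Operators

variable {V : Type*} [NormedAddCommGroup V] [InnerProductSpace ℂ V] [FiniteDimensional ℂ V]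
  [CompleteSpace H] {e : Fin n → V}

lemma sum_norm_inner_apply_sq_le_of_injective (he : Orthonormal ℂ e) {T : V →L[ℂ] H}
    (hT : Function.Injective T) (hT1 : ‖T‖ ≤ 1) (x : Fin n → H) :
    ∑ i, ‖inner ℂ (T (e i)) (x i)‖ ^ 2 ≤ hilbertMultiNorm ℂ x ^ 2 := by
  have := FiniteDimensional.complete ℂ V
  obtain ⟨U₁, U₂, hU⟩ := exists_add_linearIsometry_eq_two_smul hT hT1
  have hterm (i : Fin n) : ‖inner ℂ (T (e i)) (x i)‖ ^ 2 ≤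
      (‖inner ℂ (U₁ (e i)) (x i)‖ ^ 2 + ‖inner ℂ (U₂ (e i)) (x i)‖ ^ 2) / 2 := by
    have htwo : 2 * ‖inner ℂ (T (e i)) (x i)‖ ≤
        ‖inner ℂ (U₁ (e i)) (x i)‖ + ‖inner ℂ (U₂ (e i)) (x i)‖ := by
      have h := norm_add_le (inner ℂ (U₁ (e i)) (x i)) (inner ℂ (U₂ (e i)) (x i))
      rwa [← inner_add_left, hU, inner_smul_left, norm_mul, RCLike.norm_conj,
        Complex.norm_ofNat] at h
    have hsq := pow_le_pow_left₀ (by positivity) htwo 2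
    linarith [add_sq_le (a := ‖inner ℂ (U₁ (e i)) (x i)‖) (b := ‖inner ℂ (U₂ (e i)) (x i)‖)]
  calc ∑ i, ‖inner ℂ (T (e i)) (x i)‖ ^ 2
      ≤ (∑ i, ‖inner ℂ (U₁ (e i)) (x i)‖ ^ 2 + ∑ i, ‖inner ℂ (U₂ (e i)) (x i)‖ ^ 2) / 2 := by
        rw [← Finset.sum_add_distrib, Finset.sum_div]
        exact Finset.sum_le_sum fun i _ => hterm i
    _ ≤ (hilbertMultiNorm ℂ x ^ 2 + hilbertMultiNorm ℂ x ^ 2) / 2 := by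
        gcongr
        · exact sum_norm_inner_sq_le_of_orthonormal (he.comp_linearIsometry U₁) x
        · exact sum_norm_inner_sq_le_of_orthonormal (he.comp_linearIsometry U₂) x
    _ = hilbertMultiNorm ℂ x ^ 2 := add_self_div_two _

lemma sum_norm_inner_apply_sq_le (he : Orthonormal ℂ e) {J : V →L[ℂ] H}
    (hJ : Function.Injective J) (T : V →L[ℂ] H) (x : Fin n → H) :
    ∑ i, ‖inner ℂ (T (e i)) (x i)‖ ^ 2 ≤ ‖T‖ ^ 2 * hilbertMultiNorm ℂ x ^ 2 := by
  have hclosed : IsClosed {T : V →L[ℂ] H |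
      ∑ i, ‖inner ℂ (T (e i)) (x i)‖ ^ 2 ≤ ‖T‖ ^ 2 * hilbertMultiNorm ℂ x ^ 2} :=
    isClosed_le (by fun_prop) (by fun_prop)
  refine closure_minimal (fun S hS => ?_) hclosed (dense_setOf_injective hJ T)
  rcases eq_or_ne S 0 with rfl | hS₀
  · simp
  have hnorm : ‖S‖ ≠ 0 := norm_ne_zero_iff.2 hS₀
  have hinj : Function.Injective ((‖S‖⁻¹ : ℂ) • S) :=
    (smul_right_injective H (by simpa using hnorm)).comp hS
  have hunit : ‖(‖S‖⁻¹ : ℂ) • S‖ ≤ 1 := by simp [norm_smul, hnorm]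
  have h := sum_norm_inner_apply_sq_le_of_injective he hinj hunit x
  simp only [smul_apply, inner_smul_left, norm_mul, mul_pow,
    ← Finset.mul_sum] at h
  simpa [inv_mul_le_iff₀, hnorm, pow_pos, hS₀] using h

end Operators

/-- The operator `ℂⁿ → H` that maps the standard basis to `y`. -/
def synthesis (y : Fin n → H) : EuclideanSpace ℂ (Fin n) →L[ℂ] H :=
  LinearMap.toContinuousLinearMap ((EuclideanSpace.basisFun (Fin n) ℂ).toBasis.constr ℂ y)

lemma synthesis_basisFun (y : Fin n → H) (i : Fin n) :
    synthesis y (EuclideanSpace.basisFun (Fin n) ℂ i) = y i := by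
  simp [synthesis]

lemma injective_synthesis {y : Fin n → H} (hy : LinearIndependent ℂ y) :
    Function.Injective (synthesis y) :=
  Module.Basis.injective_constr_of_linearIndependent _ hy

lemma norm_synthesis_le_one [CompleteSpace H] {y : Fin n → H}
    (hy : ∀ w, ∑ i, ‖inner ℂ (y i) w‖ ^ 2 ≤ ‖w‖ ^ 2) : ‖synthesis y‖ ≤ 1 := by
  rw [← ContinuousLinearMap.adjoint.norm_map]
  refine ContinuousLinearMap.opNorm_le_bound _ zero_le_one fun w => ?_
  rw [one_mul, ← pow_le_pow_iff_left₀ (norm_nonneg _) (norm_nonneg _) two_ne_zero,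
    ← (EuclideanSpace.basisFun (Fin n) ℂ).sum_sq_norm_inner_right]
  simpa only [ContinuousLinearMap.adjoint_inner_right, synthesis_basisFun] using hy w

lemma exists_orthonormal_of_le_oDim [CompleteSpace H] (hn : (n : Cardinal) ≤ oDim H) :
    ∃ u : Fin n → H, Orthonormal ℂ u := by
  obtain ⟨b, -⟩ := (exists_hilbertBasis ℂ H).choose_spec
  obtain ⟨f⟩ : Nonempty (Fin n ↪ ↥(exists_hilbertBasis ℂ H).choose) := by
    rw [← Cardinal.lift_mk_le']
    simpa [oDim] using hn
  exact ⟨b ∘ f, b.orthonormal.comp f f.injective⟩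

lemma sum_norm_inner_sq_le_hilbertMultiNorm_sq [CompleteSpace H] (hn : (n : Cardinal) ≤ oDim H)
    (x : Fin n → H) {y : Fin n → H} (hy : ∀ w, ∑ i, ‖inner ℂ (y i) w‖ ^ 2 ≤ ‖w‖ ^ 2) :
    ∑ i, ‖inner ℂ (y i) (x i)‖ ^ 2 ≤ hilbertMultiNorm ℂ x ^ 2 := by
  obtain ⟨u, hu⟩ := exists_orthonormal_of_le_oDim hn
  have h := sum_norm_inner_apply_sq_le (EuclideanSpace.basisFun (Fin n) ℂ).orthonormal
    (injective_synthesis hu.linearIndependent) (synthesis y) x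
  simp only [synthesis_basisFun] at h
  exact h.trans (mul_le_of_le_one_left (sq_nonneg _)
    (pow_le_one₀ (norm_nonneg _) (norm_synthesis_le_one hy)))

end ContractiveFamilies

section Commutative

open scoped CStarAlgebra in
lemma map_cfcₙ_real {A : Type*} [NonUnitalCStarAlgebra A] (φ : A →⋆ₙₐ[ℂ] ℂ) {f : ℝ → ℝ}
    (hf : Continuous f) (hf₀ : f 0 = 0) {a : A} (ha : IsSelfAdjoint a) :
    φ (cfcₙ f a) = (f (φ a).re : ℂ) := by
  have hφa : algebraMap ℝ ℂ (φ a).re = φ a := RCLike.conj_eq_iff_re.1 (ha.map φ)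
  rw [NonUnitalStarAlgHomClass.map_cfcₙ (S := ℂ) φ f a hf.continuousOn hf₀ (map_continuous φ) ha
    (ha.map φ), cfcₙ_eq_cfc hf.continuousOn hf₀, ← hφa, cfc_algebraMap]
  simp

variable {A : Type*} [NonUnitalCStarAlgebra A] [PartialOrder A] [StarOrderedRing A]

lemma IsPureState.apply_mul_of_nonneg {τ : A →ₚ[ℂ] ℂ} (hτ : IsPureState τ)
    (hA : ∀ a b : A, a * b = b * a) {b : A} (hb : 0 ≤ b) (hb1 : ‖b‖ ≤ 1) (a : A) :
    τ (a * b) = τ a * τ b := by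
  let ρ : A →ₚ[ℂ] ℂ := PositiveLinearMap.mk₀ (τ.toLinearMap ∘ₗ LinearMap.mulRight ℂ b)
    fun a ha => τ.map_nonneg (Commute.mul_nonneg ha hb (hA a b))
  obtain ⟨t, -, -, hρ⟩ := hτ.minimal ρ fun a ha =>
    OrderHomClass.mono τ (mul_le_self_of_commute ha hb hb1 (hA a b))
  replace hρ (a : A) : τ (a * b) = t * τ a := hρ a
  have hlim := (tendsto_apply_approximateUnit τ).const_mul (t : ℂ)
  simp only [← hρ, hτ.norm_eq_one, Complex.ofReal_one, mul_one] at hlim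
  rw [hρ, tendsto_nhds_unique (tendsto_apply_approximateUnit_mul τ b) hlim, mul_comm]

lemma IsPureState.apply_mul {τ : A →ₚ[ℂ] ℂ} (hτ : IsPureState τ)
    (hA : ∀ a b : A, a * b = b * a) (a b : A) : τ (a * b) = τ a * τ b := by
  have hb : b ∈ Submodule.span ℂ ({x : A | 0 ≤ x} ∩ Metric.closedBall 0 1) := by
    simp [CStarAlgebra.span_nonneg_inter_unitClosedBall]
  induction hb using Submodule.span_induction with
  | mem b hb => exact hτ.apply_mul_of_nonneg hA hb.1 (mem_closedBall_zero_iff.1 hb.2) a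
  | zero => simp
  | add b c _ _ hb hc => rw [mul_add, map_add, map_add, hb, hc, mul_add]
  | smul r b _ hb => rw [mul_smul_comm, map_smul, map_smul, hb, mul_smul_comm]

/-- A pure state of a commutative C⋆-algebra as a character. -/
def IsPureState.toStarAlgHom {τ : A →ₚ[ℂ] ℂ} (hτ : IsPureState τ)
    (hA : ∀ a b : A, a * b = b * a) : A →⋆ₙₐ[ℂ] ℂ where
  toFun := τ
  map_smul' := map_smul τ
  map_zero' := map_zero τ
  map_add' := map_add τ
  map_mul' := hτ.apply_mul hA
  map_star' := map_star τ

lemma IsPureState.toStarAlgHom_apply {τ : A →ₚ[ℂ] ℂ} (hτ : IsPureState τ)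
    (hA : ∀ a b : A, a * b = b * a) (a : A) : hτ.toStarAlgHom hA a = τ a := rfl

lemma IsPureState.re_apply_sum_absSq {τ : A →ₚ[ℂ] ℂ} (hτ : IsPureState τ)
    (hA : ∀ a b : A, a * b = b * a) {ι : Type*} (s : Finset ι) (a : ι → A) :
    (τ (∑ i ∈ s, absSq (a i))).re = ∑ i ∈ s, ‖τ (a i)‖ ^ 2 := by
  have habsSq (b : A) : τ (absSq b) = ((‖τ b‖ ^ 2 : ℝ) : ℂ) := by
    rw [absSq, hτ.apply_mul hA, map_star τ, RCLike.star_def, Complex.conj_mul',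
      Complex.ofReal_pow]
  simp only [map_sum, habsSq, ← Complex.ofReal_sum, Complex.ofReal_re]

variable {E : Type*} [NormedAddCommGroup E] [NormedSpace ℂ E] [SMul Aᵐᵒᵖ E] [CStarModule Aᵐᵒᵖ E]
  {n : ℕ}

lemma IsPureState.norm_apply_rinner_normalize_sq {τ : A →ₚ[ℂ] ℂ} (hτ : IsPureState τ)
    (hA : ∀ a b : A, a * b = b * a) (y : E) {z : E} (hz : 0 < ‖gnsClass τ z‖) :
    ‖τ (rinner A y (normalize A (‖gnsClass τ z‖ ^ 2) z))‖ ^ 2 =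
      ‖inner ℂ (gnsClass τ y) (gnsClass τ z)‖ ^ 2 / ‖gnsClass τ z‖ ^ 2 := by
  have hcfc := map_cfcₙ_real (hτ.toStarAlgHom hA) (continuous_truncInvSqrt (pow_pos hz 2))
    (truncInvSqrt_zero _) (rinner_self_nonneg z).isSelfAdjoint
  simp only [hτ.toStarAlgHom_apply hA, ← norm_gnsClass_sq] at hcfc
  rw [normalize, rinner_smul_right, hτ.apply_mul hA, hcfc, norm_mul, mul_pow, Complex.norm_real,
    Real.norm_eq_abs, sq_abs, truncInvSqrt_self_sq (pow_pos hz 2), gnsClass_inner, div_eq_mul_inv]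

lemma IsPureState.sum_norm_inner_gnsClass_sq_le {τ : A →ₚ[ℂ] ℂ} (hτ : IsPureState τ)
    (hA : ∀ a b : A, a * b = b * a) {y : Fin n → E} (hy : muStar A y ≤ 1) (z : E) :
    ∑ i, ‖inner ℂ (gnsClass τ (y i)) (gnsClass τ z)‖ ^ 2 ≤ ‖gnsClass τ z‖ ^ 2 := by
  rcases eq_or_ne (gnsClass τ z) 0 with hz | hz
  · simp [hz]
  replace hz := norm_pos_iff.2 hz
  rw [← div_le_one (pow_pos hz 2), Finset.sum_div]
  set u := normalize A (‖gnsClass τ z‖ ^ 2) z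
  calc ∑ i, ‖inner ℂ (gnsClass τ (y i)) (gnsClass τ z)‖ ^ 2 / ‖gnsClass τ z‖ ^ 2
      = (τ (∑ i, absSq (rinner A (y i) u))).re := by
        rw [hτ.re_apply_sum_absSq hA]
        exact Finset.sum_congr rfl fun i _ => (hτ.norm_apply_rinner_normalize_sq hA (y i) hz).symm
    _ ≤ ‖∑ i, absSq (rinner A (y i) u)‖ := by
        simpa only [hτ.norm_eq_one, one_mul] using re_apply_le_norm τ _
    _ ≤ 1 := (muStar_le_one_iff y).1 hy u (norm_normalize_le_one (pow_pos hz 2) z)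

theorem starNorm_le_pureNorm (hA : ∀ a b : A, a * b = b * a)
    (hdim : ∀ τ : PureState A, (n : Cardinal) ≤ oDim (GNSSpace τ.1 E)) (x : Fin n → E) :
    starNorm A x ≤ pureNorm A x := by
  refine Real.sSup_le ?_ (pureNorm_nonneg x)
  rintro _ ⟨y, hy, rfl⟩
  rcases eq_or_ne (∑ i, absSq (rinner A (y i) (x i))) 0 with hzero | hzero
  · rw [hzero, norm_zero, Real.sqrt_zero]
    exact pureNorm_nonneg x
  obtain ⟨τ, hτ⟩ := exists_pureState_apply_eq_norm (sum_absSq_nonneg _ _) hzero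
  have hcontractive (w : GNSSpace τ.1 E) :
      ∑ i, ‖inner ℂ (gnsClass τ.1 (y i)) w‖ ^ 2 ≤ ‖w‖ ^ 2 := by
    induction w using gnsClass_induction with
    | hp => exact isClosed_le (by fun_prop) (by fun_prop)
    | h z => exact τ.2.sum_norm_inner_gnsClass_sq_le hA hy z
  have hnorm : ‖∑ i, absSq (rinner A (y i) (x i))‖ =
      ∑ i, ‖inner ℂ (gnsClass τ.1 (y i)) (gnsClass τ.1 (x i))‖ ^ 2 := by
    simp only [gnsClass_inner]
    rw [← τ.2.re_apply_sum_absSq hA, hτ, Complex.ofReal_re]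
  calc √‖∑ i, absSq (rinner A (y i) (x i))‖
      ≤ hilbertMultiNorm ℂ (fun i => gnsClass τ.1 (x i)) := by
        rw [hnorm, Real.sqrt_le_left (hilbertMultiNorm_nonneg _)]
        exact sum_norm_inner_sq_le_hilbertMultiNorm_sq (hdim τ) _ hcontractive
    _ ≤ pureNorm A x := hilbertMultiNorm_gnsClass_le_pureNorm τ x

end Commutative

end HilbertMultiNorm

end

theorem mainTheorem2_general {A E : Type*} [NonUnitalCStarAlgebra A] [PartialOrder A]
    [StarOrderedRing A] [NormedAddCommGroup E] [NormedSpace ℂ E] [SMul Aᵐᵒᵖ E]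
    [CStarModule Aᵐᵒᵖ E] {n : ℕ} (x : Fin n → E) :
    HilbertMultiNorm.hilbertMultiNorm Aᵐᵒᵖ x ≤ HilbertMultiNorm.starNorm A x ∧
    HilbertMultiNorm.hilbertMultiNorm Aᵐᵒᵖ x ≤ HilbertMultiNorm.pureNorm A x ∧
    ((∀ a b : A, a * b = b * a) →
      (∀ τ : HilbertMultiNorm.PureState A,
        (n : Cardinal) ≤ HilbertMultiNorm.oDim (HilbertMultiNorm.GNSSpace τ.1 E)) →
      HilbertMultiNorm.starNorm A x ≤ HilbertMultiNorm.pureNorm A x) :=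
  ⟨HilbertMultiNorm.hilbertMultiNorm_le_starNorm x, HilbertMultiNorm.hilbertMultiNorm_le_pureNorm x,
    fun hA hdim => HilbertMultiNorm.starNorm_le_pureNorm hA hdim x⟩

theorem mainTheorem2 {A E : Type*} [NonUnitalCStarAlgebra A] [PartialOrder A] [StarOrderedRing A]
    [NormedAddCommGroup E] [NormedSpace ℂ E] [CompleteSpace E] [SMul Aᵐᵒᵖ E] [CStarModule Aᵐᵒᵖ E]
    {n : ℕ} (x : Fin n → E) :
    HilbertMultiNorm.hilbertMultiNorm Aᵐᵒᵖ x ≤ HilbertMultiNorm.starNorm A x ∧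
    HilbertMultiNorm.hilbertMultiNorm Aᵐᵒᵖ x ≤ HilbertMultiNorm.pureNorm A x ∧
    ((∀ a b : A, a * b = b * a) →
      (∀ τ : HilbertMultiNorm.PureState A,
        (n : Cardinal) ≤ HilbertMultiNorm.oDim (HilbertMultiNorm.GNSSpace τ.1 E)) →
      HilbertMultiNorm.starNorm A x ≤ HilbertMultiNorm.pureNorm A x) := by
  exact mainTheorem2_general x
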